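/- An mm-space is a complete separable metric space $(X,d_X)$ with a Borel probability measure $\mu_X$. Two mm-spaces $X,Y$ are mm-isomorphic if there is an isometry from $\operatorname{supp}\mu_X$ onto $\operatorname{supp}\mu_Y$ pushing $\mu_X$ forward to $\mu_Y$; let $\mathcal X$ be the set of mm-isomorphism classes. Write $Y\succ X$ if there is a $1$-Lipschitz map $F:Y\to X$ with $F_*\mu_Y=\mu_X$. Let $\mathrm{Lip}_1(X)$ be the set of $1$-Lipschitz functions $X\to\mathbb R$. Let $n\in\{1,2,\dots\}\cup\{\infty\}$, $\mathbb N_n=\{i\in\mathbb N: 1\le i\le n\}$, and let $\boldsymbol\alpha=(\alpha_i)_{i\in\mathbb N_n}$ be a family of positive real numbers. For an mm-space $X$ put $$\operatorname{diam}(X;\boldsymbol\alpha)=\inf\Big\{\sup_{i\in\mathbb N_n}\operatorname{diam}A_i\Big\}\in[0,\infty],$$ where the infimum is over all families $(A_i)_{i\in\mathbb N_n}$ of pairwise disjoint Borel subsets of $X$ with $\mu_X(A_i)\ge\alpha_i$ for all $i$ (and is $\infty$ if there is no such family). The $\boldsymbol\alpha$-partial diameter and the $\boldsymbol\alpha$-observable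 diameter of $X$ are $$\underline{\operatorname{diam}}(X;\boldsymbol\alpha)=\inf_{Y\succ X}\operatorname{diam}(Y;\boldsymbol\alpha),\qquad \underline{\operatorname{ObsDiam}}(X;\boldsymbol\alpha)=\sup_{f\in\mathrm{Lip}_1(X)}\underline{\operatorname{diam}}\big((\mathbb R,|\cdot|,f_*\mu_X);\boldsymbol\alpha\big);$$ both depend only on the mm-isomorphism class of $X$. A parameter of $X$ is a Borel map $\varphi:[0,1)\to X$ with $\varphi_*\mathcal L^1=\mu_X$, where $\mathcal L^1$ is Lebesgue measure. The observable distance of $X$ and $Y$ is $$d_{\mathrm{conc}}(X,Y)=\inf_{\varphi,\psi}d_H\big(\{f\circ\varphi: f\in\mathrm{Lip}_1(X)\},\{g\circ\psi: g\in\mathrm{Lip}_1(Y)\}\big),$$ where $\varphi,\psi$ run over the parameters of $X$ and $Y$, and $d_H$ is the Hausdorff distance with respect to the Ky Fan metric $d_{KF}(f,g)=\inf\{\varepsilon\ge0:\mathcal L^1(|f-g|>\varepsilon)\le\varepsilon\}$. The topology on $\mathcal X$ induced by $d_{\mathrm{conc}}$ is called the concentration topology. Corollary. For every such $\boldsymbol\alpha$,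 the functions $\underline{\operatorname{diam}}(\,\cdot\,;\boldsymbol\alpha)$ and $\underline{\operatorname{ObsDiam}}(\,\cdot\,;\boldsymbol\alpha)$ from $\mathcal X$ to $[0,\infty]$ are lower semicontinuous with respect to the concentration topology. -/

import Mathlib

open MeasureTheory Set
open scoped ENNReal NNReal

universe u

noncomputable section

/-- An mm-space: a complete separable metric space with a Borel probability measure. -/
structure MMSpace : Type (u + 1) where
  carrier : Type u
  [metric : MetricSpace carrier]
  [complete : CompleteSpace carrier]
  [separable : TopologicalSpace.SeparableSpace carrier]
  [measurable : MeasurableSpace carrier]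
  [borel : BorelSpace carrier]
  μ : Measure carrier
  [prob : IsProbabilityMeasure μ]

namespace MMSpace

instance : CoeSort MMSpace.{u} (Type u) := ⟨carrier⟩

attribute [instance] metric complete separable measurable borel prob

instance (X : MMSpace.{u}) : SecondCountableTopology X :=
  UniformSpace.secondCountable_of_separable X

/-- Two mm-spaces are mm-isomorphic if there is an isometry between the supports of their measures
which pushes the one measure (regarded as a measure on its support) forward to the other. -/
def MMIso (X Y : MMSpace.{u}) : Prop :=
  ∃ e : X.μ.support ≃ᵢ Y.μ.support,
    (X.μ.comap Subtype.val).map e = Y.μ.comap Subtype.val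

/-- `X.Dominates Y` is the Lipschitz order `X ≻ Y`. -/
def Dominates (X Y : MMSpace.{u}) : Prop :=
  ∃ F : X → Y, LipschitzWith 1 F ∧ X.μ.map F = Y.μ

/-- The mm-space `(ℝ, f_* μ_X)` for a `1`-Lipschitz function `f` on `X`. -/
def pushReal (X : MMSpace.{u}) (f : X → ℝ) (hf : LipschitzWith 1 f) : MMSpace.{0} :=
  haveI : IsProbabilityMeasure (X.μ.map f) :=
    Measure.isProbabilityMeasure_map hf.continuous.measurable.aemeasurable
  { carrier := ℝ, μ := X.μ.map f }

end MMSpace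

/-- The set `ℕ_n = ℕ ∩ [1, n]` for `n ∈ ℕ ∪ {∞}`. -/
def NatUpTo (n : ℕ∞) : Set ℕ := {i | 1 ≤ i ∧ (i : ℕ∞) ≤ n}

/-- Finite or infinite sequences of positive real numbers, of length `n ∈ {1, 2, …} ∪ {∞}`. -/
structure MultiIndex where
  n : ℕ∞
  one_le : 1 ≤ n
  val : NatUpTo n → ℝ
  pos : ∀ i, 0 < val i

namespace MMSpace

/-- The set `D_X(α)` of families of disjoint Borel sets `A_i` with `μ_X(A_i) ≥ α_i`. -/
def families (X : MMSpace.{u}) (α : MultiIndex) : Set (NatUpTo α.n → Set X) :=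
  {A | (∀ i, MeasurableSet (A i)) ∧ Pairwise (fun i j => Disjoint (A i) (A j)) ∧
    ∀ i, ENNReal.ofReal (α.val i) ≤ X.μ (A i)}

/-- `diam(X; α)`; it is `∞` if `D_X(α)` is empty. -/
def diam (X : MMSpace.{u}) (α : MultiIndex) : ℝ≥0∞ :=
  ⨅ A ∈ X.families α, ⨆ i, Metric.ediam (A i)

/-- The `α`-partial diameter: the infimum of `diam(Y; α)` over all mm-spaces `Y ≻ X`. -/
def partialDiam (X : MMSpace.{u}) (α : MultiIndex) : ℝ≥0∞ :=
  ⨅ (Y : MMSpace.{u}) (_ : Y.Dominates X), Y.diam α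

/-- The `α`-observable diameter: the supremum of the `α`-partial diameters of `(ℝ, f_* μ_X)` over
all `1`-Lipschitz functions `f` on `X`. -/
def obsDiam (X : MMSpace.{u}) (α : MultiIndex) : ℝ≥0∞ :=
  ⨆ (f : X → ℝ) (hf : LipschitzWith 1 f), (X.pushReal f hf).partialDiam α

/-- Lebesgue measure on `[0,1)`. -/
def lebesgueI : Measure (Ico (0 : ℝ) 1) := (volume : Measure ℝ).comap Subtype.val

/-- A parameter of `X`: a Borel map `[0,1) → X` that pushes Lebesgue measure forward to `μ_X`. -/
def IsParameter (X : MMSpace.{u}) (φ : Ico (0 : ℝ) 1 → X) : Prop :=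
  Measurable φ ∧ lebesgueI.map φ = X.μ

/-- The pull-back `φ^* Lip_1(X)`. -/
def pullLip (X : MMSpace.{u}) (φ : Ico (0 : ℝ) 1 → X) : Set (Ico (0 : ℝ) 1 → ℝ) :=
  {h | ∃ f : X → ℝ, LipschitzWith 1 f ∧ h = f ∘ φ}

end MMSpace

/-- The Ky Fan distance of two real functions on a measure space. -/
def kyFan {Ω : Type*} [MeasurableSpace Ω] (μ : Measure Ω) (f g : Ω → ℝ) : ℝ≥0∞ :=
  ⨅ (ε : ℝ≥0) (_ : μ {x | (ε : ℝ) < |f x - g x|} ≤ ε), (ε : ℝ≥0∞)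

/-- The Hausdorff distance of two sets of functions with respect to the Ky Fan distance. -/
def kyFanHausdorff {Ω : Type*} [MeasurableSpace Ω] (μ : Measure Ω) (S T : Set (Ω → ℝ)) : ℝ≥0∞ :=
  (⨆ f ∈ S, ⨅ g ∈ T, kyFan μ f g) ⊔ ⨆ g ∈ T, ⨅ f ∈ S, kyFan μ g f

namespace MMSpace

/-- The observable distance. -/
def obsDist (X Y : MMSpace.{u}) : ℝ≥0∞ :=
  ⨅ (φ : Ico (0 : ℝ) 1 → X) (_ : X.IsParameter φ)
    (ψ : Ico (0 : ℝ) 1 → Y) (_ : Y.IsParameter ψ),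
    kyFanHausdorff lebesgueI (X.pullLip φ) (Y.pullLip ψ)

/-! The notions above are invariant under mm-isomorphism. -/

theorem MMIso.refl (X : MMSpace.{u}) : MMIso X X :=
  ⟨IsometryEquiv.refl _, Measure.map_id⟩

theorem MMIso.symm {X Y : MMSpace.{u}} : MMIso X Y → MMIso Y X := by
  rintro ⟨e, he⟩
  refine ⟨e.symm, ?_⟩
  rw [← he, Measure.map_map e.symm.continuous.measurable e.continuous.measurable]
  have : (e.symm ∘ e : X.μ.support → X.μ.support) = id := funext e.symm_apply_apply
  rw [this, Measure.map_id]

theorem MMIso.trans {X Y Z : MMSpace.{u}} : MMIso X Y → MMIso Y Z → MMIso X Z := by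
  rintro ⟨e, he⟩ ⟨e', he'⟩
  refine ⟨e.trans e', ?_⟩
  rw [← he', ← he, Measure.map_map e'.continuous.measurable e.continuous.measurable]
  rfl

/-- An mm-isomorphism and its inverse, extended to measurable maps of the whole spaces. -/
theorem MMIso.exists_maps {X Y : MMSpace.{u}} (h : MMIso X Y) :
    ∃ (T : X → Y) (T' : Y → X), Measurable T ∧ X.μ.map T = Y.μ ∧
      (∀ x ∈ X.μ.support, T x ∈ Y.μ.support ∧ T' (T x) = x) ∧
      (∀ x ∈ X.μ.support, ∀ y ∈ X.μ.support, edist (T x) (T y) = edist x y) ∧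
      (∀ x ∈ Y.μ.support, ∀ y ∈ Y.μ.support, edist (T' x) (T' y) = edist x y) := by
  classical
  obtain ⟨e, he⟩ := h
  have mX : MeasurableSet X.μ.support := Measure.isClosed_support.measurableSet
  have mY : MeasurableSet Y.μ.support := Measure.isClosed_support.measurableSet
  obtain ⟨x₀⟩ := nonempty_of_isProbabilityMeasure X.μ
  obtain ⟨y₀⟩ := nonempty_of_isProbabilityMeasure Y.μ
  let T : X → Y := fun x => if h : x ∈ X.μ.support then (e ⟨x, h⟩ : Y) else y₀
  let T' : Y → X := fun y => if h : y ∈ Y.μ.support then (e.symm ⟨y, h⟩ : X) else x₀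
  have hT : ∀ x (h : x ∈ X.μ.support), T x = e ⟨x, h⟩ := fun x h => dif_pos h
  have hT' : ∀ y (h : y ∈ Y.μ.support), T' y = e.symm ⟨y, h⟩ := fun y h => dif_pos h
  have mT : Measurable T :=
    Measurable.dite (measurable_subtype_coe.comp e.continuous.measurable) measurable_const mX
  refine ⟨T, T', mT, ?_, ?_, ?_, ?_⟩
  · have h1 : X.μ = (X.μ.comap (Subtype.val : X.μ.support → X)).map Subtype.val := by
      rw [map_comap_subtype_coe mX]
      exact (Measure.restrict_eq_self_of_ae_mem Measure.support_mem_ae).symm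
    have h2 : Y.μ = (Y.μ.comap (Subtype.val : Y.μ.support → Y)).map Subtype.val := by
      rw [map_comap_subtype_coe mY]
      exact (Measure.restrict_eq_self_of_ae_mem Measure.support_mem_ae).symm
    rw [h2, ← he, Measure.map_map measurable_subtype_coe e.continuous.measurable]
    conv_lhs => rw [h1, Measure.map_map mT measurable_subtype_coe]
    congr 1
    ext x
    exact hT x.1 x.2
  · intro x hx
    rw [hT x hx]
    refine ⟨(e ⟨x, hx⟩).2, ?_⟩
    rw [hT' _ (e ⟨x, hx⟩).2]
    simp
  · intro x hx y hy
    rw [hT x hx, hT y hy, ← Subtype.edist_eq, e.edist_eq, Subtype.edist_eq]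
  · intro x hx y hy
    rw [hT' x hx, hT' y hy, ← Subtype.edist_eq, e.symm.edist_eq, Subtype.edist_eq]

/-- `1`-Lipschitz functions can be pulled back along a map that is isometric on a subset. -/
theorem exists_lipschitz_extension {X Y : Type u} [MetricSpace X] [MetricSpace Y] {T : X → Y}
    {S : Set X} (hT : ∀ x ∈ S, ∀ y ∈ S, edist (T x) (T y) = edist x y) {g : Y → ℝ}
    (hg : LipschitzWith 1 g) : ∃ f : X → ℝ, LipschitzWith 1 f ∧ ∀ x ∈ S, f x = g (T x) := by
  have : LipschitzOnWith 1 (g ∘ T) S := fun x hx y hy => by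
    rw [← hT x hx y hy]
    exact hg (T x) (T y)
  obtain ⟨f, hf, hfg⟩ := this.extend_real
  exact ⟨f, hf, fun x hx => (hfg hx).symm⟩

theorem MMIso.partialDiam_le {X Y : MMSpace.{u}} (h : MMIso X Y) (α : MultiIndex) :
    Y.partialDiam α ≤ X.partialDiam α := by
  obtain ⟨T, T', mT, hT, hTm, hTd, -⟩ := h.exists_maps
  refine le_iInf₂ fun Z hZ => le_iInf₂ fun A hA => ?_
  obtain ⟨F, hF, hFμ⟩ := hZ
  have cS : IsClosed (F ⁻¹' X.μ.support) := Measure.isClosed_support.preimage hF.continuous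
  have hS : ∀ᵐ z ∂Z.μ, z ∈ F ⁻¹' X.μ.support := by
    have h1 : ∀ᵐ x ∂(Z.μ.map F), x ∈ X.μ.support := by
      rw [hFμ]
      exact Measure.support_mem_ae
    exact ae_of_ae_map hF.continuous.measurable.aemeasurable h1
  have hmap : (Z.μ.comap (Subtype.val : F ⁻¹' X.μ.support → Z)).map Subtype.val = Z.μ := by
    rw [map_comap_subtype_coe cS.measurableSet]
    exact Measure.restrict_eq_self_of_ae_mem hS
  have : CompleteSpace (F ⁻¹' X.μ.support) := cS.completeSpace_coe
  have : IsProbabilityMeasure (Z.μ.comap (Subtype.val : F ⁻¹' X.μ.support → Z)) := by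
    constructor
    rw [← preimage_univ (f := (Subtype.val : F ⁻¹' X.μ.support → Z)),
      ← Measure.map_apply measurable_subtype_coe MeasurableSet.univ, hmap, measure_univ]
  let W : MMSpace.{u} :=
    { carrier := F ⁻¹' X.μ.support, μ := Z.μ.comap (Subtype.val : F ⁻¹' X.μ.support → Z) }
  have hW : W.Dominates Y := by
    refine ⟨fun z => T (F z.1), ?_, ?_⟩
    · intro z w
      rw [hTd _ z.2 _ w.2]
      exact hF z.1 w.1
    · have : (fun z : W => T (F z.1)) = (T ∘ F) ∘ Subtype.val := rfl
      rw [this]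
      change (Z.μ.comap (Subtype.val : F ⁻¹' X.μ.support → Z)).map ((T ∘ F) ∘ Subtype.val) = _
      rw [← Measure.map_map (mT.comp hF.continuous.measurable) measurable_subtype_coe, hmap,
        ← Measure.map_map mT hF.continuous.measurable, hFμ, hT]
  refine (iInf₂_le W hW).trans ?_
  let B : NatUpTo α.n → Set W := fun i => Subtype.val ⁻¹' (A i)
  have hB : B ∈ W.families α := by
    refine ⟨fun i => measurable_subtype_coe (hA.1 i), fun i j hij => (hA.2.1 hij).preimage _,
      fun i => ?_⟩
    refine (hA.2.2 i).trans_eq ?_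
    conv_lhs => rw [← hmap, Measure.map_apply measurable_subtype_coe (hA.1 i)]
  refine (iInf₂_le B hB).trans (iSup_mono fun i => ?_)
  exact Metric.ediam_le fun x hx y hy => Metric.edist_le_ediam_of_mem (s := A i) hx hy

theorem MMIso.obsDiam_le {X Y : MMSpace.{u}} (h : MMIso X Y) (α : MultiIndex) :
    Y.obsDiam α ≤ X.obsDiam α := by
  obtain ⟨T, T', mT, hT, hTm, hTd, -⟩ := h.exists_maps
  refine iSup₂_le fun g hg => ?_
  obtain ⟨f, hf, hfg⟩ := exists_lipschitz_extension hTd hg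
  have hfe : f =ᵐ[X.μ] g ∘ T := by
    filter_upwards [Measure.support_mem_ae (μ := X.μ)] with x hx using hfg x hx
  have hμ : X.μ.map f = Y.μ.map g := by
    rw [Measure.map_congr hfe, ← Measure.map_map hg.continuous.measurable mT, hT]
  have : Y.pushReal g hg = X.pushReal f hf := by
    simp only [pushReal, hμ]
  rw [this]
  exact le_iSup₂ (f := fun f hf => (X.pushReal f hf).partialDiam α) f hf

end MMSpace

theorem kyFan_congr {Ω : Type*} [MeasurableSpace Ω] {μ : Measure Ω} {f f' g g' : Ω → ℝ}
    (hf : f =ᵐ[μ] f') (hg : g =ᵐ[μ] g') : kyFan μ f g = kyFan μ f' g' := by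
  have : ∀ ε : ℝ≥0, μ {x | (ε : ℝ) < |f x - g x|} = μ {x | (ε : ℝ) < |f' x - g' x|} := by
    intro ε
    refine measure_congr ?_
    filter_upwards [hf, hg] with x h1 h2
    change ((ε : ℝ) < |f x - g x|) = ((ε : ℝ) < |f' x - g' x|)
    rw [h1, h2]
  simp only [kyFan, this]

theorem kyFanHausdorff_symm {Ω : Type*} [MeasurableSpace Ω] (μ : Measure Ω) (S T : Set (Ω → ℝ)) :
    kyFanHausdorff μ S T = kyFanHausdorff μ T S :=
  sup_comm _ _

theorem kyFanHausdorff_le_of_ae {Ω : Type*} [MeasurableSpace Ω] {μ : Measure Ω}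
    {S S' T : Set (Ω → ℝ)} (h : ∀ f ∈ S, ∃ f' ∈ S', f =ᵐ[μ] f')
    (h' : ∀ f' ∈ S', ∃ f ∈ S, f =ᵐ[μ] f') : kyFanHausdorff μ S' T ≤ kyFanHausdorff μ S T := by
  refine sup_le_sup (iSup₂_le fun f' hf' => ?_) (iSup₂_mono fun g _ => le_iInf₂ fun f hf => ?_)
  · obtain ⟨f, hf, hff⟩ := h' f' hf'
    refine le_trans ?_ (le_iSup₂ (f := fun f (_ : f ∈ S) => ⨅ g ∈ T, kyFan μ f g) f hf)
    exact iInf₂_mono fun g _ => (kyFan_congr hff.symm (ae_eq_refl g)).le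
  · obtain ⟨f', hf', hff⟩ := h f hf
    exact (iInf₂_le f' hf').trans (kyFan_congr (ae_eq_refl g) hff.symm).le

namespace MMSpace

theorem obsDist_symm (X Y : MMSpace.{u}) : obsDist X Y = obsDist Y X := by
  have key : ∀ X Y : MMSpace.{u}, obsDist X Y ≤ obsDist Y X := fun X Y =>
    le_iInf₂ fun ψ hψ => le_iInf₂ fun φ hφ =>
      (iInf₂_le φ hφ).trans ((iInf₂_le ψ hψ).trans (kyFanHausdorff_symm _ _ _).le)
  exact le_antisymm (key X Y) (key Y X)

theorem MMIso.obsDist_le {X X' : MMSpace.{u}} (h : MMIso X X') (Y : MMSpace.{u}) :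
    obsDist X' Y ≤ obsDist X Y := by
  obtain ⟨T, T', mT, hT, hTm, hTd, hTd'⟩ := h.exists_maps
  refine le_iInf₂ fun φ hφ => le_iInf₂ fun ψ hψ => ?_
  have hφ' : X'.IsParameter (T ∘ φ) :=
    ⟨mT.comp hφ.1, by rw [← Measure.map_map mT hφ.1, hφ.2, hT]⟩
  have hS : ∀ᵐ t ∂lebesgueI, φ t ∈ X.μ.support := by
    have h1 : ∀ᵐ x ∂(lebesgueI.map φ), x ∈ X.μ.support := by
      rw [hφ.2]
      exact Measure.support_mem_ae
    exact ae_of_ae_map hφ.1.aemeasurable h1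
  refine (iInf₂_le (T ∘ φ) hφ').trans ((iInf₂_le ψ hψ).trans (kyFanHausdorff_le_of_ae ?_ ?_))
  · rintro _ ⟨f, hf, rfl⟩
    obtain ⟨g, hg, hgf⟩ := exists_lipschitz_extension hTd' hf
    refine ⟨_, ⟨g, hg, rfl⟩, ?_⟩
    filter_upwards [hS] with t ht
    simp only [Function.comp_apply]
    rw [hgf _ (hTm _ ht).1, (hTm _ ht).2]
  · rintro _ ⟨g, hg, rfl⟩
    obtain ⟨f, hf, hfg⟩ := exists_lipschitz_extension hTd hg
    refine ⟨_, ⟨f, hf, rfl⟩, ?_⟩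
    filter_upwards [hS] with t ht
    exact hfg _ ht

instance mmSetoid : Setoid MMSpace.{u} where
  r := MMIso
  iseqv := ⟨MMIso.refl, MMIso.symm, MMIso.trans⟩

end MMSpace

/-- The set `𝒳` of mm-isomorphism classes of mm-spaces. -/
def MMClass : Type (u + 1) := Quotient MMSpace.mmSetoid.{u}

namespace MMClass

/-- The `α`-partial diameter of an mm-isomorphism class. -/
def partialDiam (α : MultiIndex) : MMClass.{u} → ℝ≥0∞ :=
  Quotient.lift (fun X => X.partialDiam α) fun _ _ h =>
    le_antisymm (h.symm.partialDiam_le α) (h.partialDiam_le α)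

/-- The `α`-observable diameter of an mm-isomorphism class. -/
def obsDiam (α : MultiIndex) : MMClass.{u} → ℝ≥0∞ :=
  Quotient.lift (fun X => X.obsDiam α) fun _ _ h =>
    le_antisymm (h.symm.obsDiam_le α) (h.obsDiam_le α)

/-- The observable distance on `𝒳`. -/
def obsDist : MMClass.{u} → MMClass.{u} → ℝ≥0∞ :=
  Quotient.lift₂ MMSpace.obsDist fun X Y X' Y' hX hY => by
    have key : ∀ {X X' Y Y' : MMSpace.{u}}, X.MMIso X' → Y.MMIso Y' →
        MMSpace.obsDist X' Y' ≤ MMSpace.obsDist X Y := fun {X X' Y Y'} hX hY => by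
      refine (hX.obsDist_le Y').trans ?_
      rw [MMSpace.obsDist_symm X Y', MMSpace.obsDist_symm X Y]
      exact hY.obsDist_le X
    exact le_antisymm (key hX.symm hY.symm) (key hX hY)

/-- The concentration topology: the topology on `𝒳` induced by the observable distance. A set is
open if and only if it contains a ball of positive radius around each of its points. -/
instance concentrationTopology : TopologicalSpace MMClass.{u} where
  IsOpen U := ∀ x ∈ U, ∃ ε : ℝ≥0∞, 0 < ε ∧ ∀ y, obsDist x y < ε → y ∈ U
  isOpen_univ := fun _ _ => ⟨1, one_pos, fun _ _ => trivial⟩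
  isOpen_inter := fun U V hU hV x hx => by
    obtain ⟨ε, hε, h1⟩ := hU x hx.1
    obtain ⟨δ, hδ, h2⟩ := hV x hx.2
    exact ⟨min ε δ, lt_min hε hδ, fun y hy =>
      ⟨h1 y (hy.trans_le (min_le_left _ _)), h2 y (hy.trans_le (min_le_right _ _))⟩⟩
  isOpen_sUnion := fun S hS x hx => by
    obtain ⟨U, hU, hxU⟩ := hx
    obtain ⟨ε, hε, h⟩ := hS U hU x hxU
    exact ⟨ε, hε, fun y hy => ⟨U, hU, h y hy⟩⟩

end MMClass

end

/-! The partial diameter of `X` is governed by fractional families: submeasures `ν i` of total at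
most `μ_X`, of mass at least `α i`, each carried by a set of small diameter. Passing to some `Y ≻ X`
is exactly what lets such overlapping submeasures be realised by disjoint sets
(`HasSubmeasures.partialDiam_le`, `hasSubmeasures_of_partialDiam_lt`).

Fractional families survive concentration. If `Z k` tends to `X`, lift the submeasures of `Z k` to
`[0,1)` along a parameter and push them to `X`. There they are all dominated by the single measure
`μ_X`, so they converge setwise along an ultrafilter, and masses and the bound on the sum pass to
the limit. For the diameters, take `x`, `y` in the support of a limit measure: the function `dist ·
x` is nearly a 1-Lipschitz function on `Z k`, which oscillates by at most the diameter bound on the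
set carrying the submeasure. This is `partialDiam_le_of_approx`; the observable diameter reduces to
it by pushing everything to the line. -/

open Filter Topology

/-! ### Setwise limits and lifts of measures -/

/-- A family of measures below a finite measure `μ` converges setwise along an ultrafilter. -/
theorem exists_setwise_limit_of_le {κ Ω : Type*} [MeasurableSpace Ω] (U : Ultrafilter κ)
    (μ : Measure Ω) [IsFiniteMeasure μ] (ν : κ → Measure Ω) (h : ∀ k, ν k ≤ μ) :
    ∃ ν' : Measure Ω, ∀ B, MeasurableSet B →
      Tendsto (fun k => ν k B) (U : Filter κ) (𝓝 (ν' B)) := by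
  have ex : ∀ B : Set Ω, ∃ a : ℝ≥0∞, Tendsto (fun k => ν k B) (U : Filter κ) (𝓝 a) := fun B => by
    obtain ⟨a, -, ha⟩ := isCompact_univ.ultrafilter_le_nhds (U.map fun k => ν k B) (by simp)
    exact ⟨a, ha⟩
  choose m hm using ex
  have hle : ∀ B, m B ≤ μ B := fun B => le_of_tendsto (hm B) (Eventually.of_forall fun k => h k B)
  have hadd : ∀ A B, MeasurableSet B → Disjoint A B → m (A ∪ B) = m A + m B := fun A B hB hd => by
    refine tendsto_nhds_unique (hm _) (((hm A).add (hm B)).congr fun k => ?_)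
    exact (measure_union hd hB).symm
  have hempty : m ∅ = 0 := le_antisymm ((hle ∅).trans (by simp)) bot_le
  refine ⟨Measure.ofMeasurable (fun B _ => m B) hempty fun f hf hd => ?_, fun B hB => ?_⟩
  · have hfin : ∀ N, m (⋃ n ∈ Finset.range N, f n) = ∑ n ∈ Finset.range N, m (f n) := fun N => by
      refine tendsto_nhds_unique (hm _) ((tendsto_finsetSum _ fun n _ => hm (f n)).congr fun k => ?_)
      exact (measure_biUnion_finset (fun i _ j _ hij => hd hij) fun i _ => hf i).symm
    -- Domination by the finite measure `μ` makes the tails uniformly small, which upgrades finite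
    -- additivity of the limit to countable additivity.
    have htail : Tendsto (fun N => μ (⋃ n ≥ N, f n)) atTop (𝓝 0) :=
      tendsto_measure_biUnion_Ici_zero_of_pairwise_disjoint
        (fun i => (hf i).nullMeasurableSet) hd
    have hsplit : ∀ N, m (⋃ n, f n) = ∑ n ∈ Finset.range N, m (f n) + m (⋃ n ≥ N, f n) := fun N => by
      rw [← hfin, ← hadd _ _ (MeasurableSet.iUnion fun n => MeasurableSet.iUnion fun _ => hf n)]
      · congr 1
        ext x
        simp only [mem_iUnion, mem_union, Finset.mem_range, exists_prop]
        constructor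
        · rintro ⟨n, hn⟩
          rcases lt_or_ge n N with h | h
          exacts [Or.inl ⟨n, h, hn⟩, Or.inr ⟨n, h, hn⟩]
        · rintro (⟨n, -, hn⟩ | ⟨n, -, hn⟩) <;> exact ⟨n, hn⟩
      · simp only [disjoint_iUnion_left, disjoint_iUnion_right, Finset.mem_range]
        intro i hi j hj
        exact hd (by omega)
    have hrest : Tendsto (fun N => m (⋃ n ≥ N, f n)) atTop (𝓝 0) :=
      tendsto_of_tendsto_of_tendsto_of_le_of_le tendsto_const_nhds htail
        (fun _ => bot_le) fun _ => hle _
    have := (ENNReal.tendsto_nat_tsum fun n => m (f n)).add hrest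
    rw [add_zero] at this
    exact tendsto_nhds_unique (tendsto_const_nhds.congr hsplit) this
  · rw [Measure.ofMeasurable_apply B hB]
    exact hm B

/-- A family of measures with sum at most the image measure `P.map ψ` lifts to a family of
measures with sum at most `P`. -/
theorem exists_lift_of_sum_le_map {ι Ω Y : Type*} [Countable ι] [MeasurableSpace Ω]
    [MeasurableSpace Y] {P : Measure Ω} [IsFiniteMeasure P] {ψ : Ω → Y} (hψ : Measurable ψ)
    (ν : ι → Measure Y)
    (hν : Measure.sum ν ≤ P.map ψ) :
    ∃ ν' : ι → Measure Ω, Measure.sum ν' ≤ P ∧ (∀ i, (ν' i).map ψ = ν i) := by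
  have hle : ∀ i, ν i ≤ P.map ψ := fun i => (Measure.le_sum ν i).trans hν
  have hfin : ∀ i, IsFiniteMeasure (ν i) := fun i => isFiniteMeasure_of_le _ (hle i)
  set ρ : ι → Y → ℝ≥0∞ := fun i => (ν i).rnDeriv (P.map ψ)
  have mρ : ∀ i, Measurable (ρ i) := fun i => Measure.measurable_rnDeriv _ _
  have hρ : ∀ i, (P.map ψ).withDensity (ρ i) = ν i := fun i =>
    Measure.withDensity_rnDeriv_eq _ _ (Measure.absolutelyContinuous_of_le (hle i))
  have hsum : ∀ᵐ y ∂(P.map ψ), ∑' i, ρ i y ≤ 1 := by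
    refine ae_le_of_forall_setLIntegral_le_of_sigmaFinite (Measurable.tsum mρ)
      fun s hs _ => ?_
    rw [lintegral_tsum fun i => (mρ i).aemeasurable, lintegral_const, one_mul,
      Measure.restrict_apply_univ]
    refine le_trans (le_of_eq ?_) (hν s)
    rw [Measure.sum_apply _ hs]
    refine tsum_congr fun i => ?_
    rw [← withDensity_apply _ hs, hρ]
  have hsum' : ∀ᵐ t ∂P, ∑' i, ρ i (ψ t) ≤ 1 := ae_of_ae_map hψ.aemeasurable hsum
  -- The lift has the density of `ν i` pulled back along `ψ`; these densities still sum to at most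
  -- 1.
  refine ⟨fun i => P.withDensity (ρ i ∘ ψ), Measure.le_iff.2 fun s hs => ?_, fun i => ?_⟩
  · rw [Measure.sum_apply _ hs]
    simp only [withDensity_apply _ hs]
    rw [← lintegral_tsum fun i => ((mρ i).comp hψ).aemeasurable]
    calc ∫⁻ t in s, ∑' i, (ρ i ∘ ψ) t ∂P ≤ ∫⁻ _ in s, 1 ∂P :=
          lintegral_mono_ae (ae_restrict_of_ae hsum')
      _ = P s := by simp
  · ext s hs
    rw [Measure.map_apply hψ hs, withDensity_apply _ (hψ hs), ← hρ i, withDensity_apply _ hs,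
      setLIntegral_map hs (mρ i) hψ]
    rfl

/-! ### Partial diameter in terms of submeasures -/

namespace MMSpace

/-- `X` carries submeasures `ν_i` with total at most `μ_X` and masses at least `α_i`, each
concentrated on a set of diameter at most `c`. -/
def HasSubmeasures (X : MMSpace.{u}) (α : MultiIndex) (c : ℝ≥0∞) : Prop :=
  ∃ (ν : NatUpTo α.n → Measure X) (S : NatUpTo α.n → Set X), Measure.sum ν ≤ X.μ ∧
    (∀ i, ENNReal.ofReal (α.val i) ≤ ν i univ) ∧ (∀ i, MeasurableSet (S i)) ∧
    (∀ i, ν i (S i)ᶜ = 0) ∧ ∀ i, Metric.ediam (S i) ≤ c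

/-- Overlapping submeasures become disjoint in `X × ℕ`: layer `i` carries `ν i`, layer 0 the
remainder of `μ_X`. The projection to `X` is 1-Lipschitz, and each layer is isometric to `X`. -/
theorem HasSubmeasures.partialDiam_le {X : MMSpace.{u}} {α : MultiIndex} {c : ℝ≥0∞}
    (h : X.HasSubmeasures α c) : X.partialDiam α ≤ c := by
  obtain ⟨ν, S, hν, hmass, mS, hS, hdiam⟩ := h
  have : IsFiniteMeasure (Measure.sum ν) := isFiniteMeasure_of_le _ hν
  let M : Measure (X × ℕ) := (X.μ - Measure.sum ν).map (fun x => (x, 0)) +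
    Measure.sum fun i => (ν i).map fun x => (x, (i : ℕ))
  have mpair : ∀ n : ℕ, Measurable fun x : X => (x, n) := fun n => measurable_prodMk_right
  have hM : M.map Prod.fst = X.μ := by
    ext s hs
    rw [Measure.map_apply measurable_fst hs, Measure.add_apply,
      Measure.map_apply (mpair 0) (measurable_fst hs), Measure.sum_apply _ (measurable_fst hs)]
    conv_rhs => rw [← Measure.sub_add_cancel_of_le hν, Measure.add_apply, Measure.sum_apply _ hs]
    congr 1
    refine tsum_congr fun i => ?_
    rw [Measure.map_apply (mpair _) (measurable_fst hs)]
    rfl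
  have : IsProbabilityMeasure M := by
    constructor
    rw [← preimage_univ (f := (Prod.fst : X × ℕ → X)),
      ← Measure.map_apply measurable_fst MeasurableSet.univ, hM, measure_univ]
  let W : MMSpace.{u} := { carrier := X × ℕ, μ := M }
  have hW : W.Dominates X := ⟨Prod.fst, LipschitzWith.prod_fst, hM⟩
  refine (iInf₂_le W hW).trans ?_
  let A : NatUpTo α.n → Set W := fun i => S i ×ˢ {(i : ℕ)}
  have mA : ∀ i, MeasurableSet (A i) := fun i => (mS i).prod (measurableSet_singleton _)
  have hA : A ∈ W.families α := by
    refine ⟨mA, fun i j hij => ?_, fun i => ?_⟩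
    · exact Set.disjoint_prod.2 (Or.inr (by simpa [Subtype.ext_iff] using hij))
    · calc ENNReal.ofReal (α.val i) ≤ ν i univ := hmass i
        _ = ν i (S i) := by
          rw [← measure_add_measure_compl (mS i), hS i, add_zero]
        _ = (ν i).map (fun x => (x, (i : ℕ))) (A i) := by
          rw [Measure.map_apply (mpair _) (mA i)]
          congr 1
          ext x
          simp [A]
        _ ≤ (Measure.sum fun i => (ν i).map fun x => (x, (i : ℕ))) (A i) :=
          Measure.le_sum (fun i : NatUpTo α.n => (ν i).map fun x => (x, (i : ℕ))) i (A i)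
        _ ≤ M (A i) := by
          rw [Measure.add_apply]
          exact le_add_self
  refine (iInf₂_le A hA).trans (iSup_le fun i => Metric.ediam_le fun x hx y hy => ?_)
  have h2 : x.2 = y.2 := hx.2.trans hy.2.symm
  have h1 := (Metric.edist_le_ediam_of_mem hx.1 hy.1).trans (hdiam i)
  change max (edist x.1 y.1) (edist x.2 y.2) ≤ c
  rw [h2, edist_self]
  exact max_le h1 bot_le

/-- Restricting `μ_Y` to disjoint sets and pushing forward to `X` gives the submeasures. Images need
not be Borel, but their closures are, with the same diameter. -/
theorem hasSubmeasures_of_partialDiam_lt {X : MMSpace.{u}} {α : MultiIndex} {c : ℝ≥0∞}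
    (h : X.partialDiam α < c) : X.HasSubmeasures α c := by
  simp only [partialDiam, diam, iInf_lt_iff] at h
  obtain ⟨Y, ⟨F, hF, hFμ⟩, A, hA, hc⟩ := h
  have mF : Measurable F := hF.continuous.measurable
  refine ⟨fun i => (Y.μ.restrict (A i)).map F, fun i => closure (F '' A i), ?_, fun i => ?_,
    fun i => isClosed_closure.measurableSet, fun i => ?_, fun i => ?_⟩
  · rw [← hFμ]
    refine Measure.le_iff.2 fun s hs => ?_
    rw [Measure.sum_apply _ hs, Measure.map_apply mF hs]
    simp only [Measure.map_apply mF hs, Measure.restrict_apply (mF hs)]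
    rw [← measure_iUnion (fun i j hij => (hA.2.1 hij).mono inter_subset_right inter_subset_right)
      fun i => (mF hs).inter (hA.1 i)]
    exact measure_mono (iUnion_subset fun i => inter_subset_left)
  · rw [Measure.map_apply mF MeasurableSet.univ, preimage_univ, Measure.restrict_apply_univ]
    exact hA.2.2 i
  · rw [Measure.map_apply mF isClosed_closure.measurableSet.compl,
      Measure.restrict_apply (mF isClosed_closure.measurableSet.compl)]
    refine measure_mono_null (t := ∅) ?_ measure_empty
    rintro x ⟨hx, hxA⟩
    exact hx (subset_closure (mem_image_of_mem F hxA))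
  · rw [Metric.ediam_closure]
    refine (Metric.ediam_le ?_).trans ((le_iSup (fun i => Metric.ediam (A i)) i).trans hc.le)
    rintro _ ⟨x, hx, rfl⟩ _ ⟨y, hy, rfl⟩
    exact ((hF x y).trans (by simp)).trans (Metric.edist_le_ediam_of_mem hx hy)

/-! ### Passage to the limit along couplings -/

instance : IsProbabilityMeasure lebesgueI := by
  constructor
  rw [lebesgueI, Measure.comap_apply _ Subtype.val_injective
    (fun s hs => measurableSet_Ico.subtype_image hs) _ MeasurableSet.univ, image_univ,
    Subtype.range_coe, Real.volume_Ico]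
  simp

theorem exists_of_kyFan_lt {Ω : Type*} [MeasurableSpace Ω] {P : Measure Ω} {f g : Ω → ℝ}
    {δ : ℝ≥0∞} (h : kyFan P f g < δ) :
    ∃ ε : ℝ≥0, (ε : ℝ≥0∞) < δ ∧ P {x | (ε : ℝ) < |f x - g x|} ≤ ε := by
  simp only [kyFan, iInf_lt_iff] at h
  obtain ⟨ε, h1, h2⟩ := h
  exact ⟨ε, h2, h1⟩

/-- If the `1`-Lipschitz functions on `X` are approximated by those on `Z k` along couplings, then
`α`-partial diameter bounds pass to the limit. -/
theorem partialDiam_le_of_approx {X : MMSpace.{u}} {Z : ℕ → MMSpace.{u}} {α : MultiIndex}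
    {c : ℝ≥0∞} {Ω : Type*} [MeasurableSpace Ω] {P : Measure Ω} [IsProbabilityMeasure P]
    {φ : ℕ → Ω → X} {ψ : ∀ k, Ω → Z k} {δ : ℕ → ℝ≥0∞}
    (mφ : ∀ k, Measurable (φ k)) (hφ : ∀ k, P.map (φ k) = X.μ)
    (mψ : ∀ k, Measurable (ψ k)) (hψ : ∀ k, P.map (ψ k) = (Z k).μ)
    (hδ : Tendsto δ atTop (𝓝 0))
    (happ : ∀ k (f : X → ℝ), LipschitzWith 1 f → ∃ g : Z k → ℝ, LipschitzWith 1 g ∧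
      kyFan P (f ∘ φ k) (g ∘ ψ k) < δ k)
    (hc : ∀ k, (Z k).partialDiam α ≤ c) : X.partialDiam α ≤ c := by
  -- The infimum need not be attained, so submeasures on `Z k` are available only for bounds `c' >
  -- c`.
  refine le_of_forall_gt_imp_ge_of_dense fun c' hc' => ?_
  rcases eq_or_ne c' ∞ with rfl | hc'top
  · exact le_top
  choose ν S hν hmass mS hS hdiam using fun k =>
    hasSubmeasures_of_partialDiam_lt ((hc k).trans_lt hc')
  choose ρ hρ hρν using fun k => exists_lift_of_sum_le_map (P := P) (mψ k) (ν k)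
    ((hν k).trans_eq (hψ k).symm)
  have hρle : ∀ k, Measure.sum (fun i => (ρ k i).map (φ k)) ≤ X.μ := fun k => by
    rw [← hφ k]
    refine Measure.le_iff.2 fun s hs => ?_
    rw [Measure.sum_apply _ hs, Measure.map_apply (mφ k) hs]
    simp only [Measure.map_apply (mφ k) hs]
    rw [← Measure.sum_apply _ (mφ k hs)]
    exact hρ k _
  let U : Ultrafilter ℕ := Ultrafilter.of atTop
  have hU : (U : Filter ℕ) ≤ atTop := Ultrafilter.of_le atTop
  choose τ hτ using fun i => exists_setwise_limit_of_le U X.μ (fun k => (ρ k i).map (φ k))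
    fun k => (Measure.le_sum (fun i => (ρ k i).map (φ k)) i).trans (hρle k)
  -- Only finite partial sums are passed to the limit; their supremum is the full sum.
  have hτle : Measure.sum τ ≤ X.μ := by
    refine Measure.le_iff.2 fun s hs => ?_
    rw [Measure.sum_apply _ hs, ENNReal.tsum_eq_iSup_sum]
    refine iSup_le fun F => le_of_tendsto (tendsto_finsetSum F fun i _ => hτ i s hs)
      (Eventually.of_forall fun k => ?_)
    refine (ENNReal.sum_le_tsum F).trans ?_
    rw [← Measure.sum_apply _ hs]
    exact hρle k s
  refine HasSubmeasures.partialDiam_le ⟨τ, fun i => (τ i).support, hτle, fun i => ?_,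
    fun i => Measure.isClosed_support.measurableSet, fun i => Measure.support_mem_ae,
    fun i => Metric.ediam_le fun x hx y hy => ?_⟩
  · refine ge_of_tendsto (hτ i univ MeasurableSet.univ) (Eventually.of_forall fun k => ?_)
    refine (hmass k i).trans_eq ?_
    rw [← hρν k i, Measure.map_apply (mψ k) MeasurableSet.univ,
      Measure.map_apply (mφ k) MeasurableSet.univ, preimage_univ, preimage_univ]
  rw [edist_dist]
  refine ENNReal.ofReal_le_of_le_toReal (le_of_forall_pos_le_add fun η hη => ?_)
  -- The mass of a ball around a support point has a positive limit, so it eventually exceeds `δ k`,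
  -- the bound for the exceptional set.
  have near : ∀ z ∈ (τ i).support, ∀ᶠ k in (U : Filter ℕ),
      δ k < (ρ k i) (φ k ⁻¹' Metric.ball z (η / 4)) := fun z hz => by
    have hpos : 0 < τ i (Metric.ball z (η / 4)) :=
      Measure.mem_support_iff_forall z |>.1 hz _ (Metric.ball_mem_nhds z (by positivity))
    filter_upwards [(hδ.mono_left hU).eventually_lt (hτ i _ measurableSet_ball) hpos] with k hk
    rwa [Measure.map_apply (mφ k) measurableSet_ball] at hk
  have hsmall : ∀ᶠ k in (U : Filter ℕ), δ k < ENNReal.ofReal (η / 4) :=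
    (hδ.mono_left hU).eventually_lt_const (by simpa using hη)
  obtain ⟨k, hkx, hky, hk⟩ := ((near x hx).and ((near y hy).and hsmall)).exists
  obtain ⟨g, hg, hfg⟩ := happ k (fun z => dist z x) (LipschitzWith.dist_left x)
  obtain ⟨ε, hε, hPε⟩ := exists_of_kyFan_lt hfg
  have hε' : (ε : ℝ) < η / 4 := by
    have := hε.trans hk
    rwa [← ENNReal.ofReal_coe_nnreal, ENNReal.ofReal_lt_ofReal_iff (by positivity)] at this
  -- The points `t` with `ψ k t` outside `S k i` are `ρ k i`-null, and those where the approximation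
  -- fails have mass at most `ε < δ k`; together they cannot cover the preimage of the ball.
  have good : ∀ z, δ k < (ρ k i) (φ k ⁻¹' Metric.ball z (η / 4)) → ∃ t,
      dist (φ k t) z < η / 4 ∧ ψ k t ∈ S k i ∧ |dist (φ k t) x - g (ψ k t)| ≤ ε := fun z hz => by
    by_contra! hcon
    have hsub : φ k ⁻¹' Metric.ball z (η / 4) ⊆ ψ k ⁻¹' (S k i)ᶜ ∪
        {t | (ε : ℝ) < |((fun z => dist z x) ∘ φ k) t - (g ∘ ψ k) t|} := fun t ht => by
      by_cases hS : ψ k t ∈ S k i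
      exacts [Or.inr (hcon t ht hS), Or.inl hS]
    have h0 : ρ k i (ψ k ⁻¹' (S k i)ᶜ) = 0 := by
      rw [← Measure.map_apply (mψ k) (mS k i).compl, hρν, hS k i]
    have h1 := ((Measure.le_sum (ρ k) i).trans (hρ k))
      {t | (ε : ℝ) < |((fun z => dist z x) ∘ φ k) t - (g ∘ ψ k) t|}
    have := (measure_mono hsub).trans (measure_union_le (μ := ρ k i) _ _)
    rw [h0, zero_add] at this
    exact absurd (hz.trans_le (this.trans (h1.trans hPε))) hε.le.not_gt
  obtain ⟨s, hs, hsS, hsε⟩ := good x hkx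
  obtain ⟨t, ht, htS, htε⟩ := good y hky
  have hgst : dist (g (ψ k s)) (g (ψ k t)) ≤ c'.toReal := by
    rw [dist_edist]
    refine ENNReal.toReal_mono hc'top (((hg _ _).trans (by simp)).trans
      ((Metric.edist_le_ediam_of_mem hsS htS).trans (hdiam k i)))
  rw [Real.dist_eq] at hgst
  have htri : dist x y ≤ dist (φ k t) x + dist (φ k t) y := dist_triangle_left _ _ _
  have := abs_le.1 hgst
  have := abs_le.1 hsε
  have := abs_le.1 htε
  -- The error is at most two radii `η / 4` and two Ky Fan errors `ε < η / 4`, hence at most `η`.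
  linarith

/-! ### Sequences converging in the observable distance -/

theorem exists_approx_of_obsDist_lt {X Y : MMSpace.{u}} {δ : ℝ≥0∞} (h : X.obsDist Y < δ) :
    ∃ (φ : Ico (0 : ℝ) 1 → X) (ψ : Ico (0 : ℝ) 1 → Y), X.IsParameter φ ∧ Y.IsParameter ψ ∧
      ∀ f : X → ℝ, LipschitzWith 1 f → ∃ g : Y → ℝ, LipschitzWith 1 g ∧
        kyFan lebesgueI (f ∘ φ) (g ∘ ψ) < δ := by
  simp only [obsDist, iInf_lt_iff] at h
  obtain ⟨φ, hφ, ψ, hψ, hlt⟩ := h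
  refine ⟨φ, ψ, hφ, hψ, fun f hf => ?_⟩
  have h1 : ⨅ g ∈ Y.pullLip ψ, kyFan lebesgueI (f ∘ φ) g < δ :=
    (le_iSup₂ (f := fun f (_ : f ∈ X.pullLip φ) => ⨅ g ∈ Y.pullLip ψ, kyFan lebesgueI f g)
      (f ∘ φ) ⟨f, hf, rfl⟩).trans_lt (le_sup_left.trans_lt hlt)
  simp only [iInf_lt_iff] at h1
  obtain ⟨_, ⟨g, hg, rfl⟩, hlt⟩ := h1
  exact ⟨g, hg, hlt⟩

theorem kyFan_comp_le {Ω : Type*} [MeasurableSpace Ω] (P : Measure Ω) (f g : Ω → ℝ) {h : ℝ → ℝ}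
    (hh : LipschitzWith 1 h) : kyFan P (h ∘ f) (h ∘ g) ≤ kyFan P f g := by
  refine le_iInf₂ fun ε hε => iInf₂_le ε ((measure_mono fun t ht => ?_).trans hε)
  refine lt_of_lt_of_le (mem_ofPred.1 ht) ?_
  simpa [Real.dist_eq] using hh.dist_le_mul (f t) (g t)

theorem partialDiam_le_of_tendsto {X : MMSpace.{u}} {Z : ℕ → MMSpace.{u}} {α : MultiIndex}
    {c : ℝ≥0∞} {δ : ℕ → ℝ≥0∞} (hδ : Tendsto δ atTop (𝓝 0)) (hZ : ∀ k, X.obsDist (Z k) < δ k)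
    (hc : ∀ k, (Z k).partialDiam α ≤ c) : X.partialDiam α ≤ c := by
  choose φ ψ hφ hψ happ using fun k => exists_approx_of_obsDist_lt (hZ k)
  exact partialDiam_le_of_approx (fun k => (hφ k).1) (fun k => (hφ k).2) (fun k => (hψ k).1)
    (fun k => (hψ k).2) hδ happ hc

theorem obsDiam_le_of_tendsto {X : MMSpace.{u}} {Z : ℕ → MMSpace.{u}} {α : MultiIndex}
    {c : ℝ≥0∞} {δ : ℕ → ℝ≥0∞} (hδ : Tendsto δ atTop (𝓝 0)) (hZ : ∀ k, X.obsDist (Z k) < δ k)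
    (hc : ∀ k, (Z k).obsDiam α ≤ c) : X.obsDiam α ≤ c := by
  refine iSup₂_le fun f hf => ?_
  choose φ ψ hφ hψ happ using fun k => exists_approx_of_obsDist_lt (hZ k)
  choose g hg hfg using fun k => happ k f hf
  have mf : Measurable f := hf.continuous.measurable
  have mg : ∀ k, Measurable (g k) := fun k => (hg k).continuous.measurable
  -- On the line, the test function `h` is approximated by `h` itself: composing with it does not
  -- increase the Ky Fan distance of `f ∘ φ k` and `g k ∘ ψ k`.
  refine partialDiam_le_of_approx (X := X.pushReal f hf) (P := lebesgueI)
    (Z := fun k => (Z k).pushReal (g k) (hg k))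
    (φ := fun k => f ∘ φ k) (ψ := fun k => g k ∘ ψ k)
    (fun k => mf.comp (hφ k).1) (fun k => ?_) (fun k => (mg k).comp (hψ k).1) (fun k => ?_) hδ
    (fun k h hh => ⟨h, hh, (kyFan_comp_le _ _ _ hh).trans_lt (hfg k)⟩)
    fun k => (le_iSup₂ (f := fun g hg => ((Z k).pushReal g hg).partialDiam α) (g k) (hg k)).trans
      (hc k)
  · change lebesgueI.map (f ∘ φ k) = X.μ.map f
    rw [← (hφ k).2, Measure.map_map mf (hφ k).1]
  · change lebesgueI.map (g k ∘ ψ k) = (Z k).μ.map (g k)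
    rw [← (hψ k).2, Measure.map_map (mg k) (hψ k).1]

end MMSpace

/-! ### Sequential criterion and conclusion -/

/-- A function on `𝒳` is lower semicontinuous if its upper bounds pass to limits of sequences. -/
theorem MMClass.lowerSemicontinuous_of_seq {F : MMClass.{u} → ℝ≥0∞}
    (h : ∀ (X : MMSpace.{u}) (Z : ℕ → MMSpace.{u}) (δ : ℕ → ℝ≥0∞) (c : ℝ≥0∞),
      Tendsto δ atTop (𝓝 0) → (∀ k, X.obsDist (Z k) < δ k) →
      (∀ k, F (Quotient.mk MMSpace.mmSetoid (Z k)) ≤ c) →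
      F (Quotient.mk MMSpace.mmSetoid X) ≤ c) : LowerSemicontinuous F := by
  refine lowerSemicontinuous_iff_isOpen_preimage.2 fun c x hx => ?_
  induction x using Quotient.inductionOn with
  | h X =>
    -- If no ball around `X` lies in `{F > c}`, balls of radius `1 / (k + 1)` yield a sequence
    -- tending to `X` with `F ≤ c`.
    by_contra! hcon
    have hpos : ∀ k : ℕ, (0 : ℝ≥0∞) < ((k : ℝ≥0∞) + 1)⁻¹ := fun k => by
      simp [ENNReal.add_eq_top]
    choose y hy hyc using fun k : ℕ => hcon _ (hpos k)
    have hδ : Tendsto (fun k : ℕ => ((k : ℝ≥0∞) + 1)⁻¹) atTop (𝓝 0) := by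
      have := (tendsto_add_atTop_iff_nat 1).2 ENNReal.tendsto_inv_nat_nhds_zero
      simpa using this
    choose Z hZ using fun k => Quotient.exists_rep (y k)
    refine absurd (h X Z _ c hδ (fun k => ?_) fun k => ?_) (not_le.2 hx)
    · have := hy k
      rw [← hZ k] at this
      exact this
    · rw [hZ k]
      exact not_lt.1 (hyc k)

theorem mainTheorem7 (α : MultiIndex) :
    LowerSemicontinuous (MMClass.partialDiam α : MMClass.{u} → ENNReal) ∧
      LowerSemicontinuous (MMClass.obsDiam α : MMClass.{u} → ENNReal) :=
  ⟨MMClass.lowerSemicontinuous_of_seq fun _ _ _ _ hδ hZ hc =>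
      MMSpace.partialDiam_le_of_tendsto hδ hZ hc,
    MMClass.lowerSemicontinuous_of_seq fun _ _ _ _ hδ hZ hc =>
      MMSpace.obsDiam_le_of_tendsto hδ hZ hc⟩
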